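/- Let $G$ be a connected noncompact real Lie group with trivial center whose Lie algebra $\mathfrak g$ is simple, let $K\subset G$ be a maximal compact subgroup whose center has positive dimension, and let $\Gamma\subset G$ be a closed torsionfree discrete subgroup. Put $M_\Gamma=K\backslash G/\Gamma$. Let $\mathcal E_G$ be the quotient of $(K\backslash G)\times G$ that identifies $(a,g)$ with $(a\gamma^{-1},\gamma g)$ for $\gamma\in\Gamma$; with the projection $[a,g]\mapsto a\Gamma$ and the right translations of $G$ on the second factor it is a principal $G$-bundle on $M_\Gamma$. Let $\mathcal D^0$ be the flat connection on $\mathcal E_G$ to which the pullback of the left-invariant Maurer--Cartan form of $G$ along $(K\backslash G)\times G\to G$ descends, and let $\mathcal E_K=\{[Kg^{-1},g] : g\in G\}\subset\mathcal E_G$, a reduction of structure group to $K$. Let $X$ be a compact connected $C^\infty$ manifold with base point, $\beta:\widetilde X\to X$ its universal cover with the right action of $\pi_1(X)$ by deck transformations, and $\rho:\pi_1(X)\to\Gamma$ a homomorphism such that the adjoint action of $\rho(\pi_1(X))$ on $\mathfrak g$ is completely reducible. Let $E_G$ be the principal $G$-bundle on $X$ that is the quotient of $\widetilde X\times G$ by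 the identifications $(x,g)\sim(x\cdot z,\rho(z)^{-1}g)$, $z\in\pi_1(X)$, and let $D$ be the flat connection on $E_G$ to which the trivial connection on $\widetilde X\times G\to\widetilde X$ descends. Let $E_K\subset E_G$ be any $C^\infty$ reduction of structure group to $K$, let $h:\widetilde X\to G/K$ be the corresponding $\pi_1(X)$-equivariant map (so that $[x,g]\in E_K$ if and only if $h(x)=gK$), let $\iota:G/K\to K\backslash G$ be the map $gK\mapsto Kg^{-1}$, and let $H_D:X\to M_\Gamma$ be the map to which $\iota\circ h$ descends. Then $H_D$ is $C^\infty$, and $$\Phi: E_G\to H_D^*\mathcal E_G,\qquad [x,g]\mapsto\bigl(\beta(x),[\iota(h(x)),g]\bigr)$$ is a well-defined isomorphism of $C^\infty$ principal $G$-bundles over $X$. This canonical identification takes 1. the pulled back connection $H_D^*\mathcal D^0$ to the connection $D$ on $E_G$, that is, $\Phi^*(H_D^*\mathcal D^0)=D$, and 2. the reduction $H_D^*\mathcal E_K\subset H_D^*\mathcal E_G$ to the reduction $E_K\subset E_G$, that is, $\Phi(E_K)=H_D^*\mathcal E_K$. -/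

import Mathlib

open scoped Manifold ContDiff
open Diffeology

set_option linter.unusedSectionVars false
set_option linter.unusedVariables false

noncomputable section

namespace FlatPullback

open Set Filter Topology

/-! ### Diffeologies of manifolds, products, subsets and quotients

Smooth manifolds are a full subcategory of the diffeological spaces of Mathlib (a map between
manifolds is `C^∞` iff it maps plots to plots). A quotient by a surjective submersion (for instance
by a free proper action) carries the quotient diffeology, and an embedded submanifold the subset
diffeology. The smooth structures of all the quotients below are given in this way. -/

/-- A manifold as a diffeological space: its plots are the `C^∞` maps `ℝⁿ → M`. -/
@[reducible]
def manifoldDiffeology (E M : Type*) [NormedAddCommGroup E] [NormedSpace ℝ E]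
    [TopologicalSpace M] [ChartedSpace E M] : DiffeologicalSpace M :=
  .ofCorePlotsOn {
    isPlotOn := fun {n u} _ p ↦ ContMDiffOn 𝓘(ℝ, EuclideanSpace ℝ (Fin n)) 𝓘(ℝ, E) ∞ p u
    isPlotOn_congr := fun _ _ _ h ↦ ⟨fun H ↦ H.congr fun x hx ↦ (h hx).symm,
      fun H ↦ H.congr fun x hx ↦ h hx⟩
    isPlot := fun {n} p ↦ ContMDiff 𝓘(ℝ, EuclideanSpace ℝ (Fin n)) 𝓘(ℝ, E) ∞ p
    isPlotOn_univ := contMDiffOn_univ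
    isPlot_const := fun _ ↦ contMDiff_const
    isPlotOn_reparam := fun _ _ _ h hp hf ↦ hp.comp hf.contMDiffOn h
    locality := fun _ _ h x hxu ↦ by
      let ⟨v, hv, hxv, hv'⟩ := h x hxu
      exact ((hv' x hxv).contMDiffAt (hv.mem_nhds hxv)).contMDiffWithinAt }

/-- Near each of its points, `ℝⁿ` has smooth self-maps into a prescribed neighbourhood that are
the identity close to the point. -/
lemma exists_cutoff {n : ℕ} {u : Set (EuclideanSpace ℝ (Fin n))} {x : EuclideanSpace ℝ (Fin n)}
    (hu : u ∈ 𝓝 x) : ∃ f : EuclideanSpace ℝ (Fin n) → EuclideanSpace ℝ (Fin n),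
      ContDiff ℝ ∞ f ∧ (∀ y, f y ∈ u) ∧ f =ᶠ[𝓝 x] id := by
  obtain ⟨ε, hε, hεu⟩ := Metric.mem_nhds_iff.1 hu
  let b : ContDiffBump x := ⟨ε / 4, ε / 2, by positivity, by linarith⟩
  refine ⟨fun y ↦ x + b y • (y - x), ?_, fun y ↦ hεu ?_, ?_⟩
  · exact contDiff_const.add (b.contDiff.smul (contDiff_id.sub contDiff_const))
  · rw [Metric.mem_ball, dist_eq_norm, add_sub_cancel_left, norm_smul, Real.norm_eq_abs,
      abs_of_nonneg b.nonneg]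
    by_cases hy : dist y x < ε / 2
    · rw [dist_eq_norm] at hy
      calc b y * ‖y - x‖ ≤ 1 * ‖y - x‖ := by gcongr; exact b.le_one
        _ < ε := by linarith
    · rw [b.zero_of_le_dist (not_lt.1 hy), zero_mul]
      exact hε
  · filter_upwards [b.eventuallyEq_one] with y hy
    simp [hy]

/-- The product diffeology: plots are pairs of plots. -/
@[reducible]
def prodDiffeology {A B : Type*} (dA : DiffeologicalSpace A) (dB : DiffeologicalSpace B) :
    DiffeologicalSpace (A × B) where
  plots n := {p | (fun t ↦ (p t).1) ∈ dA.plots n ∧ (fun t ↦ (p t).2) ∈ dB.plots n}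
  constant_plots x := ⟨dA.constant_plots x.1, dB.constant_plots x.2⟩
  plot_reparam hp hf := ⟨dA.plot_reparam hp.1 hf, dB.plot_reparam hp.2 hf⟩
  locality hp := by
    refine ⟨dA.locality fun x ↦ ?_, dB.locality fun x ↦ ?_⟩
    all_goals
      obtain ⟨u, hu, hxu, h⟩ := hp x
      refine ⟨u, hu, hxu, fun hf hf' ↦ ?_⟩
    exacts [(h hf hf').1, (h hf hf').2]

/-- The subset diffeology: plots are the plots of the ambient space with values in the subset. -/
@[reducible]
def subtypeDiffeology {A : Type*} (dA : DiffeologicalSpace A) (S : A → Prop) :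
    DiffeologicalSpace (Subtype S) where
  plots n := {p | (fun t ↦ (p t).1) ∈ dA.plots n}
  constant_plots x := dA.constant_plots x.1
  plot_reparam hp hf := dA.plot_reparam hp hf
  locality hp := dA.locality fun x ↦ by
    obtain ⟨u, hu, hxu, h⟩ := hp x
    exact ⟨u, hu, hxu, fun hf hf' ↦ h hf hf'⟩

/-- The quotient diffeology along a surjection `q : A → B`: the plots of `B` are the maps that
lift locally to plots of `A`. -/
@[reducible]
def quotientDiffeology {A B : Type*} (dA : DiffeologicalSpace A) (q : A → B)
    (hq : Function.Surjective q) : DiffeologicalSpace B where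
  plots n := {p | ∀ x, ∃ r ∈ dA.plots n, q ∘ r =ᶠ[𝓝 x] p}
  constant_plots b _ := by
    obtain ⟨a, rfl⟩ := hq b
    exact ⟨_, dA.constant_plots a, .rfl⟩
  plot_reparam {n m p f} hp hf x := by
    obtain ⟨r, hr, h⟩ := hp (f x)
    exact ⟨r ∘ f, dA.plot_reparam hr hf, hf.continuous.continuousAt.eventually h⟩
  locality {n p} hp x := by
    obtain ⟨u, hu, hxu, h⟩ := hp x
    obtain ⟨f, hf, hfu, hfx⟩ := exists_cutoff (hu.mem_nhds hxu)
    obtain ⟨r, hr, h'⟩ := h hfu hf x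
    refine ⟨r, hr, ?_⟩
    filter_upwards [h', hfx] with y hy hy'
    rw [hy, Function.comp_apply, hy', id]

lemma dSmooth_quotientMap {A B : Type*} [dA : DiffeologicalSpace A] (q : A → B)
    (hq : Function.Surjective q) :
    letI := quotientDiffeology dA q hq
    DSmooth q :=
  fun _ p hp _ ↦ ⟨p, hp, .rfl⟩

/-! ### Vector-valued one-forms -/

/-- A smooth `V`-valued one-form on a diffeological space: a smooth `V`-valued one-form on `ℝⁿ` for
every plot, compatible with smooth changes of parameters. On a manifold these are the usual
smooth `V`-valued one-forms, the form on `ℝⁿ` being the pullback along the plot. -/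
structure OneForm (V : Type*) [NormedAddCommGroup V] [NormedSpace ℝ V]
    (P : Type*) [DiffeologicalSpace P] where
  /-- The pullback of the form along a plot. -/
  toFun : ∀ {n : ℕ} (p : EuclideanSpace ℝ (Fin n) → P), IsPlot p →
    EuclideanSpace ℝ (Fin n) → (EuclideanSpace ℝ (Fin n) →L[ℝ] V)
  smooth : ∀ {n : ℕ} (p : EuclideanSpace ℝ (Fin n) → P) (hp : IsPlot p),
    ContDiff ℝ ∞ (toFun p hp)
  reparam : ∀ {n m : ℕ} (p : EuclideanSpace ℝ (Fin m) → P) (hp : IsPlot p)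
    (f : EuclideanSpace ℝ (Fin n) → EuclideanSpace ℝ (Fin m)) (hf : ContDiff ℝ ∞ f)
    (x : EuclideanSpace ℝ (Fin n)),
    toFun (p ∘ f) (isPlot_reparam hp hf) x = (toFun p hp (f x)).comp (fderiv ℝ f x)

namespace OneForm

variable {V : Type*} [NormedAddCommGroup V] [NormedSpace ℝ V]

/-- The pullback of a one-form along a smooth map. -/
def pullback {P Q : Type*} [DiffeologicalSpace P] [DiffeologicalSpace Q] (θ : OneForm V Q)
    (f : P → Q) (hf : DSmooth f) : OneForm V P where
  toFun p hp := θ.toFun (f ∘ p) (hf _ p hp)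
  smooth _ _ := θ.smooth _ _
  reparam p hp g hg x := θ.reparam (f ∘ p) (hf _ p hp) g hg x

@[ext]
lemma ext {P : Type*} [DiffeologicalSpace P] {θ η : OneForm V P}
    (h : ∀ (n : ℕ) (p : EuclideanSpace ℝ (Fin n) → P) (hp : IsPlot p) x,
      θ.toFun p hp x = η.toFun p hp x) : θ = η := by
  obtain ⟨a, _, _⟩ := θ
  obtain ⟨b, _, _⟩ := η
  have : @a = @b := by
    funext n p hp x
    exact h n p hp x
  subst this
  rfl

/-- The value of a one-form at a point depends only on the germ of the plot. -/
lemma congr_germ {P : Type*} [DiffeologicalSpace P] (θ : OneForm V P) {n : ℕ}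
    {p r : EuclideanSpace ℝ (Fin n) → P} (hp : IsPlot p) (hr : IsPlot r)
    {x : EuclideanSpace ℝ (Fin n)} (h : p =ᶠ[𝓝 x] r) : θ.toFun p hp x = θ.toFun r hr x := by
  obtain ⟨f, hf, hfu, hfx⟩ := exists_cutoff h
  have hpr : p ∘ f = r ∘ f := funext hfu
  have hd : fderiv ℝ f x = ContinuousLinearMap.id ℝ _ := by
    rw [hfx.fderiv_eq, fderiv_id]
  have hx : f x = x := hfx.self_of_nhds
  have h₁ := θ.reparam p hp f hf x
  have h₂ := θ.reparam r hr f hf x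
  rw [hd, hx, ContinuousLinearMap.comp_id] at h₁ h₂
  rw [← h₁, ← h₂]
  congr 1

/-- A one-form `α` on `A` that takes the same value on any two plots with the same image in the
quotient `B` is the pullback of exactly one one-form on `B`. -/
theorem existsUnique_descent {A B : Type*} [dA : DiffeologicalSpace A] (q : A → B)
    (hq : Function.Surjective q) (α : OneForm V A)
    (hα : ∀ (n : ℕ) (p r : EuclideanSpace ℝ (Fin n) → A) (hp : IsPlot p) (hr : IsPlot r),
      q ∘ p = q ∘ r → α.toFun p hp = α.toFun r hr) :
    letI := quotientDiffeology dA q hq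
    ∃! θ : OneForm V B, θ.pullback q (dSmooth_quotientMap q hq) = α := by
  let _ := quotientDiffeology dA q hq
  have loc : ∀ (n : ℕ) (p r : EuclideanSpace ℝ (Fin n) → A) (hp : IsPlot p) (hr : IsPlot r) (x),
      q ∘ p =ᶠ[𝓝 x] q ∘ r → α.toFun p hp x = α.toFun r hr x := by
    intro n p r hp hr x h
    obtain ⟨f, hf, hfu, hfx⟩ := exists_cutoff h
    have h₁ : p ∘ f =ᶠ[𝓝 x] p := by
      filter_upwards [hfx] with y hy
      rw [Function.comp_apply, hy, id]
    have h₂ : r ∘ f =ᶠ[𝓝 x] r := by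
      filter_upwards [hfx] with y hy
      rw [Function.comp_apply, hy, id]
    rw [← α.congr_germ (isPlot_reparam hp hf) hp h₁, ← α.congr_germ (isPlot_reparam hr hf) hr h₂,
      hα n _ _ (isPlot_reparam hp hf) (isPlot_reparam hr hf) (funext hfu)]
  choose lift lift_plot lift_eq using
    fun (n : ℕ) (p : EuclideanSpace ℝ (Fin n) → B) (hp : IsPlot p) ↦ hp
  have hlift : ∀ n p hp x, IsPlot (lift n p hp x) := fun n p hp x ↦ lift_plot n p hp x
  classical
  refine ⟨⟨fun {n} p hp x ↦ α.toFun (lift n p hp x) (hlift n p hp x) x, ?_, ?_⟩, ?_, ?_⟩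
  · intro n p hp
    refine contDiff_iff_contDiffAt.2 fun x ↦ ?_
    refine (α.smooth (lift n p hp x) (hlift n p hp x)).contDiffAt.congr_of_eventuallyEq ?_
    filter_upwards [(lift_eq n p hp x).eventually_nhds] with y hy
    exact loc n _ _ _ _ y ((lift_eq n p hp y).trans (hy.mono fun z hz ↦ Eq.symm hz))
  · intro n m p hp f hf x
    rw [← α.reparam]
    · refine loc _ _ _ _ _ x ((lift_eq n (p ∘ f) (isPlot_reparam hp hf) x).trans ?_)
      exact (hf.continuous.continuousAt.eventually (lift_eq m p hp (f x))).mono fun y hy ↦ hy.symm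
    · exact hf
  · refine OneForm.ext fun n p hp x ↦ ?_
    exact loc n _ _ _ _ x (lift_eq n (q ∘ p) (dSmooth_quotientMap q hq n p hp) x)
  · rintro η rfl
    refine OneForm.ext fun n p hp x ↦ ?_
    have hpl : IsPlot (q ∘ lift n p hp x) := fun y ↦ ⟨_, hlift n p hp x, .rfl⟩
    exact (η.congr_germ hpl hp (lift_eq n p hp x)).symm

end OneForm

/-! ### Lie groups -/

section LieGroup

variable (E : Type*) [NormedAddCommGroup E] [NormedSpace ℝ E]
  {G : Type*} [TopologicalSpace G] [ChartedSpace E G] [Group G]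

/-- The Lie algebra of the Lie group `G` is simple. -/
def HasSimpleLieAlgebra (G : Type*) [TopologicalSpace G] [ChartedSpace E G] [Group G]
    [FiniteDimensional ℝ E] [LieGroup 𝓘(ℝ, E) ∞ G] : Prop :=
  haveI : CompleteSpace E := FiniteDimensional.complete ℝ E
  haveI : LieGroup 𝓘(ℝ, E) (minSmoothness ℝ 3) G :=
    LieGroup.of_le (n := ∞) (by
      rw [minSmoothness_of_isRCLikeNormedField]
      exact ENat.LEInfty.out)
  LieAlgebra.IsSimple ℝ (GroupLieAlgebra 𝓘(ℝ, E) G)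

/-- The adjoint action of `g` on `𝔤 = T₁G`: the derivative at `1` of `x ↦ g x g⁻¹`. The tangent
space at `g 1 g⁻¹ = 1` is `T₁G`. -/
def Ad (g : G) : GroupLieAlgebra 𝓘(ℝ, E) G →L[ℝ] GroupLieAlgebra 𝓘(ℝ, E) G :=
  mfderiv 𝓘(ℝ, E) 𝓘(ℝ, E) (fun x : G ↦ g * x * g⁻¹) 1

/-- The adjoint action of the subset `S` of `G` on `𝔤` is completely reducible: every invariant
subspace has an invariant complement. -/
def AdCompletelyReducible (S : Set G) : Prop :=
  ∀ W : Submodule ℝ (GroupLieAlgebra 𝓘(ℝ, E) G), (∀ g ∈ S, ∀ w ∈ W, Ad E g w ∈ W) →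
    ∃ W' : Submodule ℝ (GroupLieAlgebra 𝓘(ℝ, E) G),
      (∀ g ∈ S, ∀ w ∈ W', Ad E g w ∈ W') ∧ IsCompl W W'

/-- The left-invariant Maurer-Cartan form of `G` at `g`: the derivative at `g` of left translation
by `g⁻¹`, from `T_g G` to `T₁ G = 𝔤`. As a vector space `T₁ G` is the model space `E`. -/
def maurerCartan (g : G) : TangentSpace 𝓘(ℝ, E) g →L[ℝ] E :=
  mfderiv 𝓘(ℝ, E) 𝓘(ℝ, E) (fun x : G ↦ g⁻¹ * x) g

/-- The pullback of the Maurer-Cartan form along a map `p` from a vector space: `p⁻¹ dp`. -/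
def pullbackMaurerCartan {n : ℕ} (p : EuclideanSpace ℝ (Fin n) → G) (x : EuclideanSpace ℝ (Fin n)) :
    EuclideanSpace ℝ (Fin n) →L[ℝ] E :=
  (maurerCartan E (p x)).comp (mfderiv 𝓘(ℝ, EuclideanSpace ℝ (Fin n)) 𝓘(ℝ, E) p x)

variable [LieGroup 𝓘(ℝ, E) ∞ G]

lemma pullbackMaurerCartan_eq {n : ℕ} {p : EuclideanSpace ℝ (Fin n) → G}
    (hp : ContMDiff 𝓘(ℝ, EuclideanSpace ℝ (Fin n)) 𝓘(ℝ, E) ∞ p) (x : EuclideanSpace ℝ (Fin n)) :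
    pullbackMaurerCartan E p x =
    mfderiv 𝓘(ℝ, EuclideanSpace ℝ (Fin n)) 𝓘(ℝ, E) (fun y ↦ (p x)⁻¹ * p y) x :=
  (mfderiv_comp (I' := 𝓘(ℝ, E)) x
    ((contMDiff_mul_left (n := ∞)).contMDiffAt.mdifferentiableAt (by simp))
    (hp.contMDiffAt.mdifferentiableAt (by simp))).symm

lemma inTangentCoordinates_of_const {n : ℕ} (a : EuclideanSpace ℝ (Fin n) → G)
    (ϕ : EuclideanSpace ℝ (Fin n) → (EuclideanSpace ℝ (Fin n) →L[ℝ] E))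
    (x₀ x : EuclideanSpace ℝ (Fin n)) (h : a x = a x₀) :
    inTangentCoordinates 𝓘(ℝ, EuclideanSpace ℝ (Fin n)) 𝓘(ℝ, E) id a ϕ x₀ x = ϕ x := by
  rw [inTangentCoordinates_eq _ _ _ (by simp [chartAt_self_eq]) (by rw [h]; exact mem_chart_source _ _)]
  have key : ∀ b c : G, b = c → ∀ v,
      (tangentBundleCore 𝓘(ℝ, E) G).coordChange (achart E b) (achart E c) b v = v := by
    rintro b _ rfl v
    exact (tangentBundleCore 𝓘(ℝ, E) G).coordChange_self _ _ (mem_achart_source _ _) v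
  ext v
  simp only [ContinuousLinearMap.comp_apply]
  rw [key _ _ h]
  congr 1
  exact (tangentBundleCore 𝓘(ℝ, EuclideanSpace ℝ (Fin n)) (EuclideanSpace ℝ (Fin n))).coordChange_self
    (achart _ x) x (mem_achart_source _ _) v

/-- The Maurer-Cartan form as a one-form on `G`. -/
def maurerCartanForm (G : Type*) [TopologicalSpace G] [ChartedSpace E G] [Group G]
    [LieGroup 𝓘(ℝ, E) ∞ G] :
    letI := manifoldDiffeology E G
    OneForm E G :=
  letI := manifoldDiffeology E G
  { toFun := fun p _ x ↦ pullbackMaurerCartan E p x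
    smooth := fun {n} p hp ↦ by
      have hp : ContMDiff 𝓘(ℝ, EuclideanSpace ℝ (Fin n)) 𝓘(ℝ, E) ∞ p := hp
      refine contDiff_iff_contDiffAt.2 fun x₀ ↦ ?_
      have h := ContMDiffAt.mfderiv (x₀ := x₀) (m := ∞) (n := ∞)
        (I := 𝓘(ℝ, EuclideanSpace ℝ (Fin n)))
        (J := 𝓘(ℝ, EuclideanSpace ℝ (Fin n))) (I' := 𝓘(ℝ, E))
        (fun x y : EuclideanSpace ℝ (Fin n) ↦ (p x)⁻¹ * p y) id
        (((hp.comp contMDiff_fst).inv.mul (hp.comp contMDiff_snd)).contMDiffAt)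
        contMDiffAt_id (by simp)
      rw [contMDiffAt_iff_contDiffAt] at h
      refine h.congr_of_eventuallyEq (.of_forall fun x ↦ ?_)
      refine (pullbackMaurerCartan_eq E hp x).trans ?_
      exact (inTangentCoordinates_of_const E (fun x ↦ (p x)⁻¹ * p x) _ x₀ x (by simp)).symm
    reparam := fun {n m} p hp f hf x ↦ by
      have hp : ContMDiff 𝓘(ℝ, EuclideanSpace ℝ (Fin m)) 𝓘(ℝ, E) ∞ p := hp
      have h := mfderiv_comp (I' := 𝓘(ℝ, EuclideanSpace ℝ (Fin m))) x
        (hp.contMDiffAt.mdifferentiableAt (by simp))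
        (hf.contMDiff.contMDiffAt.mdifferentiableAt (by simp))
      rw [mfderiv_eq_fderiv] at h
      exact congrArg (fun L ↦ (maurerCartan E (p (f x))).comp L) h }

/-- Left translation by a locally constant factor does not change `p⁻¹dp`. -/
lemma pullbackMaurerCartan_mul_left {n : ℕ} {p r : EuclideanSpace ℝ (Fin n) → G}
    (hp : ContMDiff 𝓘(ℝ, EuclideanSpace ℝ (Fin n)) 𝓘(ℝ, E) ∞ p)
    (hr : ContMDiff 𝓘(ℝ, EuclideanSpace ℝ (Fin n)) 𝓘(ℝ, E) ∞ r)
    (γ : EuclideanSpace ℝ (Fin n) → G) (x : EuclideanSpace ℝ (Fin n))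
    (hγ : ∀ᶠ y in 𝓝 x, γ y = γ x) (h : ∀ y, r y = γ y * p y) :
    pullbackMaurerCartan E r x = pullbackMaurerCartan E p x := by
  rw [pullbackMaurerCartan_eq E hp, pullbackMaurerCartan_eq E hr]
  have : (fun y ↦ (r x)⁻¹ * r y) =ᶠ[𝓝 x] fun y ↦ (p x)⁻¹ * p y := by
    filter_upwards [hγ] with y hy
    rw [h, h, hy]
    group
  exact this.mfderiv_eq

/-- The product of a diffeological space `B` with a Lie group `G`. -/
@[reducible]
def prodLieDiffeology (B G : Type*) [dB : DiffeologicalSpace B]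
    [TopologicalSpace G] [ChartedSpace E G] : DiffeologicalSpace (B × G) :=
  prodDiffeology dB (manifoldDiffeology E G)

/-- The trivial connection on the trivial principal bundle `B × G → B`: the pullback of the
left-invariant Maurer-Cartan form along the projection `B × G → G`. -/
def trivialConnection (B G : Type*) [DiffeologicalSpace B]
    [TopologicalSpace G] [ChartedSpace E G] [Group G] [LieGroup 𝓘(ℝ, E) ∞ G] :
    letI := prodLieDiffeology E B G
    OneForm E (B × G) :=
  letI := prodLieDiffeology E B G
  letI := manifoldDiffeology E G
  (maurerCartanForm E G).pullback Prod.snd fun _ _ hp ↦ hp.2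

/-- The quotient of `B × G` by an equivalence relation, with the quotient diffeology. -/
@[reducible]
def prodLieQuotientDiffeology {B G : Type*} [DiffeologicalSpace B]
    [TopologicalSpace G] [ChartedSpace E G] (s : Setoid (B × G)) :
    DiffeologicalSpace (Quotient s) :=
  quotientDiffeology (prodLieDiffeology E B G) (Quotient.mk s) Quotient.mk_surjective

/-- If the classes of an equivalence relation on `B × G` change the second factor only by left
multiplication with elements of a discrete subgroup, the trivial connection descends uniquely. -/
theorem existsUnique_trivialConnection_descends {B : Type*} [DiffeologicalSpace B]
    (Γ : Subgroup G) [DiscreteTopology Γ] (s : Setoid (B × G))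
    (hs : ∀ u v : B × G, s u v → ∃ γ ∈ Γ, v.2 = γ * u.2) :
    letI := prodLieDiffeology E B G
    letI := prodLieQuotientDiffeology E s
    ∃! θ : OneForm E (Quotient s),
      θ.pullback (Quotient.mk s) (dSmooth_quotientMap _ _) = trivialConnection E B G := by
  let _ := prodLieDiffeology E B G
  refine OneForm.existsUnique_descent (Quotient.mk s) Quotient.mk_surjective _ ?_
  intro n p r hp hr hpr
  have hp2 : ContMDiff 𝓘(ℝ, EuclideanSpace ℝ (Fin n)) 𝓘(ℝ, E) ∞ fun t ↦ (p t).2 := hp.2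
  have hr2 : ContMDiff 𝓘(ℝ, EuclideanSpace ℝ (Fin n)) 𝓘(ℝ, E) ∞ fun t ↦ (r t).2 := hr.2
  choose γ hγ hγ' using fun t ↦ hs (p t) (r t) (Quotient.exact (congrFun hpr t))
  have hcont : Continuous γ := by
    have : γ = fun t ↦ (r t).2 * (p t).2⁻¹ := by
      funext t
      rw [hγ' t, mul_inv_cancel_right]
    rw [this]
    exact (hr2.mul hp2.inv).continuous
  have hcontΓ : Continuous fun t ↦ (⟨γ t, hγ t⟩ : Γ) := hcont.subtype_mk hγ
  funext x
  refine (pullbackMaurerCartan_mul_left E hp2 hr2 γ x ?_ hγ').symm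
  have := hcontΓ.continuousAt.eventually ((isOpen_discrete {(⟨γ x, hγ x⟩ : Γ)}).mem_nhds rfl)
  exact this.mono fun y hy ↦ congrArg Subtype.val hy

/-- The connection on a quotient of `B × G` whose pullback to `B × G` is the trivial connection. -/
def descendedConnection {B : Type*} [DiffeologicalSpace B]
    (Γ : Subgroup G) [DiscreteTopology Γ] (s : Setoid (B × G))
    (hs : ∀ u v : B × G, s u v → ∃ γ ∈ Γ, v.2 = γ * u.2) :
    letI := prodLieQuotientDiffeology E s
    OneForm E (Quotient s) :=
  (existsUnique_trivialConnection_descends E Γ s hs).choose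

end LieGroup

/-! ### Deck transformations of the universal cover -/

section Deck

variable {X Xt : Type*} [TopologicalSpace X] [TopologicalSpace Xt]
  [SimplyConnectedSpace Xt] {β : Xt → X}

lemma existsUnique_lift (F : Type*) [NormedAddCommGroup F] [NormedSpace ℝ F]
    [ChartedSpace F Xt] (hβ : IsCoveringMap β) (a b : Xt) (hab : β a = β b) : 
    ∃! T : C(Xt, Xt), T a = b ∧ β ∘ T = β := by
  have : LocallyPathConnectedSpace Xt := ChartedSpace.locallyPathConnectedSpace F Xt
  exact hβ.existsUnique_continuousMap_lifts ⟨β, hβ.continuous⟩ a b hab.symm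

variable (F : Type*) [NormedAddCommGroup F] [NormedSpace ℝ F] [ChartedSpace F Xt]
  (hβ : IsCoveringMap β) (x₀ : Xt)

/-- The deck transformation of the universal cover `β : Xt → X` given by `z ∈ π₁(X, β x₀)`: the
unique continuous map over `X` that sends `x₀` to the end point of the lift of `z` starting at `x₀`.
In the convention of Mathlib the product `z * w` of two loops is `w` followed by `z`; in this
convention `deck z` is the right action of `z` on `Xt`. -/
def deck (z : FundamentalGroup X (β x₀)) : C(Xt, Xt) :=
  (existsUnique_lift F hβ x₀ (hβ.monodromy z ⟨x₀, rfl⟩ : Xt)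
    (hβ.monodromy z ⟨x₀, rfl⟩).2.symm).choose

lemma deck_base (z : FundamentalGroup X (β x₀)) :
    deck F hβ x₀ z x₀ = hβ.monodromy z ⟨x₀, rfl⟩ :=
  (existsUnique_lift F hβ x₀ (hβ.monodromy z ⟨x₀, rfl⟩ : Xt)
    (hβ.monodromy z ⟨x₀, rfl⟩).2.symm).choose_spec.1.1

lemma proj_deck (z : FundamentalGroup X (β x₀)) (x : Xt) : β (deck F hβ x₀ z x) = β x :=
  congrFun (existsUnique_lift F hβ x₀ (hβ.monodromy z ⟨x₀, rfl⟩ : Xt)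
    (hβ.monodromy z ⟨x₀, rfl⟩).2.symm).choose_spec.1.2 x

lemma lift_ext (F : Type*) [NormedAddCommGroup F] [NormedSpace ℝ F]
    [ChartedSpace F Xt] (hβ : IsCoveringMap β) {S T : C(Xt, Xt)} (hS : β ∘ S = β) (hT : β ∘ T = β) (a : Xt) (h : S a = T a) :
    S = T :=
  (existsUnique_lift F hβ a (T a) (congrFun hT a).symm).unique ⟨h, hS⟩ ⟨rfl, hT⟩

lemma deck_one (x : Xt) : deck F hβ x₀ 1 x = x := by
  have : deck F hβ x₀ 1 = ContinuousMap.id Xt := by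
    refine lift_ext F hβ (funext (proj_deck F hβ x₀ 1)) rfl x₀ ?_
    rw [deck_base, FundamentalGroup.one_def, IsCoveringMap.monodromy_refl]
    rfl
  rw [this]
  rfl

lemma deck_mul (z w : FundamentalGroup X (β x₀)) (x : Xt) :
    deck F hβ x₀ (z * w) x = deck F hβ x₀ w (deck F hβ x₀ z x) := by
  have : deck F hβ x₀ (z * w) = (deck F hβ x₀ w).comp (deck F hβ x₀ z) := by
    refine lift_ext F hβ (funext (proj_deck F hβ x₀ _)) ?_ x₀ ?_
    · funext y
      simp [proj_deck]
    · rw [deck_base, FundamentalGroup.mul_def, IsCoveringMap.monodromy_trans_apply,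
        ContinuousMap.comp_apply, deck_base]
      have hwp : β (deck F hβ x₀ w x₀) = β x₀ := proj_deck F hβ x₀ w x₀
      have hT : (ContinuousMap.mk β hβ.continuous).comp (deck F hβ x₀ w) = ⟨β, hβ.continuous⟩ := by
        ext y
        exact proj_deck F hβ x₀ w y
      let Λ := (hβ.liftPathQuotient z ⟨x₀, rfl⟩).map (deck F hβ x₀ w)
      have hbase : hβ.monodromy w ⟨x₀, rfl⟩ = (⟨deck F hβ x₀ w x₀, hwp⟩ : β ⁻¹' {β x₀}) :=
        Subtype.ext (deck_base F hβ x₀ w).symm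
      rw [hbase]
      have key := hβ.monodromy_eq_of_map_eq (γ := z) (ex := ⟨deck F hβ x₀ w x₀, hwp⟩)
        (ey := ⟨deck F hβ x₀ w (hβ.monodromy z ⟨x₀, rfl⟩),
          (proj_deck F hβ x₀ w _).trans (hβ.monodromy z ⟨x₀, rfl⟩).2⟩) Λ (by
          have h := hβ.map_liftPathQuotient z ⟨x₀, rfl⟩
          have heq : ∀ (f g : C(Xt, X)), f = g → (hβ.liftPathQuotient z ⟨x₀, rfl⟩).map f ≍
              (hβ.liftPathQuotient z ⟨x₀, rfl⟩).map g := by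
            rintro f _ rfl
            rfl
          refine eq_of_heq (HEq.trans ?_ (Path.Homotopic.Quotient.cast_heq _ _).symm)
          refine HEq.trans (heq_of_eq Path.Homotopic.Quotient.map_comp.symm) ?_
          refine (heq _ _ hT).trans ((heq_of_eq h).trans ?_)
          exact Path.Homotopic.Quotient.cast_heq _ _)
      exact congrArg Subtype.val key
  rw [this]
  rfl

/-- Two points in a fibre of the universal cover differ by a deck transformation. -/
lemma exists_deck_eq (x y : Xt) (h : β x = β y) : ∃ z, deck F hβ x₀ z x = y := by
  obtain ⟨S, ⟨hSx, hS⟩, -⟩ := existsUnique_lift F hβ x y h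
  let c : Path.Homotopic.Quotient x₀ (S x₀) := .mk (PathConnectedSpace.somePath x₀ (S x₀))
  let z : FundamentalGroup X (β x₀) :=
    (c.map ⟨β, hβ.continuous⟩).cast rfl (congrFun hS x₀).symm
  have hz : hβ.monodromy z ⟨x₀, rfl⟩ = ⟨S x₀, congrFun hS x₀⟩ :=
    hβ.monodromy_eq_of_map_eq c (by
      refine eq_of_heq (HEq.symm ?_)
      exact (Path.Homotopic.Quotient.cast_heq _ _).trans (Path.Homotopic.Quotient.cast_heq _ _))
  refine ⟨z, ?_⟩
  rw [← hSx, lift_ext F hβ (funext (proj_deck F hβ x₀ z)) hS x₀ (by rw [deck_base, hz])]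

/-- The fundamental group acts freely on the universal cover. -/
lemma eq_one_of_deck_eq (z : FundamentalGroup X (β x₀)) (x : Xt) (h : deck F hβ x₀ z x = x) :
    z = 1 := by
  have hT : deck F hβ x₀ z = ContinuousMap.id Xt :=
    lift_ext F hβ (funext (proj_deck F hβ x₀ z)) rfl x h
  have hM : (⟨x₀, rfl⟩ : β ⁻¹' {β x₀}) = hβ.monodromy z ⟨x₀, rfl⟩ :=
    Subtype.ext ((congrArg (fun T : C(Xt, Xt) ↦ T x₀) hT).symm.trans (deck_base F hβ x₀ z))
  have hmap := hβ.map_liftPathQuotient z ⟨x₀, rfl⟩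
  have key : ∀ (e : β ⁻¹' {β x₀}) (he : (⟨x₀, rfl⟩ : β ⁻¹' {β x₀}) = e)
      (c : Path.Homotopic.Quotient x₀ e.1), c.map ⟨β, hβ.continuous⟩ =
        Path.Homotopic.Quotient.cast (FundamentalGroup.toPath z) rfl e.2 → z = 1 := by
    rintro _ rfl c hc
    have : c = Path.Homotopic.Quotient.refl x₀ := Subsingleton.elim _ _
    rw [this] at hc
    exact (eq_of_heq ((heq_of_eq hc).trans (Path.Homotopic.Quotient.cast_heq _ _))).symm
  exact key _ hM _ hmap

end Deck

/-! ### The flat bundle of a representation of the fundamental group -/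

section FlatBundle

variable (E F : Type*) [NormedAddCommGroup E] [NormedSpace ℝ E]
  [NormedAddCommGroup F] [NormedSpace ℝ F]
  {G X Xt : Type*} [TopologicalSpace G] [ChartedSpace E G] [Group G]
  [TopologicalSpace X] [TopologicalSpace Xt] [ChartedSpace F Xt] [SimplyConnectedSpace Xt]
  {β : Xt → X} (hβ : IsCoveringMap β) (x₀ : Xt)
  {Γ : Subgroup G} (ρ : FundamentalGroup X (β x₀) →* Γ)

/-- Two points `(x₁, g₁)`, `(x₂, g₂)` of `Xt × G` are identified if `x₂ = x₁ · z` and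
`g₂ = ρ(z)⁻¹ g₁` for some `z` in the fundamental group. -/
def flatSetoid : Setoid (Xt × G) where
  r u v := ∃ z : FundamentalGroup X (β x₀), v.1 = deck F hβ x₀ z u.1 ∧ v.2 = (ρ z : G)⁻¹ * u.2
  iseqv :=
    { refl := fun u ↦ ⟨1, (deck_one F hβ x₀ u.1).symm, by rw [map_one]; simp⟩
      symm := by
        rintro u v ⟨z, h₁, h₂⟩
        refine ⟨z⁻¹, ?_, by simp [h₂]⟩
        rw [h₁, ← deck_mul, mul_inv_cancel, deck_one]
      trans := by
        rintro u v w ⟨z, h₁, h₂⟩ ⟨z', h₃, h₄⟩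
        exact ⟨z * z', by rw [h₃, h₁, deck_mul], by rw [h₄, h₂, map_mul]; simp [mul_assoc]⟩ }

/-- The principal `G`-bundle `E_G` over `X` given by `ρ`, the quotient of `Xt × G`. (Here and
below the model spaces `E` of `G` and `F` of `X`, `Xt` are arguments of the types so that the smooth
structure of the quotient can be an instance.) -/
def FlatBundle (E F : Type*) [NormedAddCommGroup F] [NormedSpace ℝ F] {G X Xt : Type*} [Group G]
    [TopologicalSpace X] [TopologicalSpace Xt] [ChartedSpace F Xt] [SimplyConnectedSpace Xt]
    {β : Xt → X} (hβ : IsCoveringMap β) (x₀ : Xt) {Γ : Subgroup G}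
    (ρ : FundamentalGroup X (β x₀) →* Γ) : Type _ :=
  Quotient (flatSetoid F hβ x₀ ρ)

namespace FlatBundle

instance : DiffeologicalSpace (FlatBundle E F hβ x₀ ρ) :=
  letI := manifoldDiffeology F Xt
  prodLieQuotientDiffeology E (flatSetoid F hβ x₀ ρ)

variable {E F hβ x₀ ρ}

/-- The class of `(x, g)` in `E_G`. -/
def mk (x : Xt) (g : G) : FlatBundle E F hβ x₀ ρ :=
  Quotient.mk (flatSetoid F hβ x₀ ρ) (x, g)

lemma mk_eq_mk {x y : Xt} {g k : G} :
    (mk x g : FlatBundle E F hβ x₀ ρ) = mk y k ↔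
      ∃ z : FundamentalGroup X (β x₀), y = deck F hβ x₀ z x ∧ k = (ρ z : G)⁻¹ * g :=
  Quotient.eq (r := flatSetoid F hβ x₀ ρ)

lemma exists_mk (e : FlatBundle E F hβ x₀ ρ) : ∃ x g, mk x g = e :=
  Quotient.inductionOn e fun u ↦ ⟨u.1, u.2, rfl⟩

/-- The bundle projection `E_G → X`. -/
def proj : FlatBundle E F hβ x₀ ρ → X :=
  Quotient.lift (fun u : Xt × G ↦ β u.1) (by
    rintro u v ⟨z, h, -⟩
    exact (h ▸ proj_deck F hβ x₀ z u.1).symm)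

/-- The right action of `G` on `E_G`, by right translations of the second factor of `Xt × G`. -/
instance : MulAction Gᵐᵒᵖ (FlatBundle E F hβ x₀ ρ) where
  smul g := Quotient.map (sa := flatSetoid F hβ x₀ ρ) (sb := flatSetoid F hβ x₀ ρ)
    (fun u ↦ (u.1, u.2 * g.unop)) (by
      rintro u v ⟨z, h₁, h₂⟩
      exact ⟨z, h₁, by simp [h₂, mul_assoc]⟩)
  one_smul e := by
    obtain ⟨x, g, rfl⟩ := exists_mk e
    exact congrArg (mk x) (mul_one g)
  mul_smul a b e := by
    obtain ⟨x, g, rfl⟩ := exists_mk e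
    exact congrArg (mk x) (mul_assoc g b.unop a.unop).symm

variable (E F hβ x₀ ρ)

/-- The flat connection `D` on `E_G`: its pullback to `Xt × G` is the trivial connection. -/
def connection [LieGroup 𝓘(ℝ, E) ∞ G] [DiscreteTopology Γ] : OneForm E (FlatBundle E F hβ x₀ ρ) :=
  letI := manifoldDiffeology F Xt
  descendedConnection E Γ (flatSetoid F hβ x₀ ρ) (by
    rintro u v ⟨z, -, h⟩
    exact ⟨(ρ z : G)⁻¹, Γ.inv_mem (ρ z).2, h⟩)

end FlatBundle

/-- A `C^∞` reduction of structure group of `E_G` to the subgroup `K`: a subset of `E_G` that meets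
every fibre in a `K`-orbit and has smooth local sections around every point of `X`. -/
structure IsReduction [ChartedSpace F X] (K : Subgroup G) (EK : Set (FlatBundle E F hβ x₀ ρ)) :
    Prop where
  smul_mem : ∀ e ∈ EK, ∀ k ∈ K, MulOpposite.op k • e ∈ EK
  exists_smul_eq : ∀ e ∈ EK, ∀ e' ∈ EK, e.proj = e'.proj → ∃ k ∈ K, e' = MulOpposite.op k • e
  exists_section : ∀ x : X, ∃ U : Set X, IsOpen U ∧ x ∈ U ∧
    ∃ s : X → FlatBundle E F hβ x₀ ρ, (∀ y ∈ U, (s y).proj = y ∧ s y ∈ EK) ∧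
      ∀ (n : ℕ) (p : EuclideanSpace ℝ (Fin n) → X),
        ContMDiff 𝓘(ℝ, EuclideanSpace ℝ (Fin n)) 𝓘(ℝ, F) ∞ p → (∀ t, p t ∈ U) → IsPlot (s ∘ p)

end FlatBundle

/-! ### The homogeneous space `K \ G`, the locally symmetric space `K \ G / Γ` -/

section Quotients

variable (E : Type*) [NormedAddCommGroup E] [NormedSpace ℝ E]
  {G : Type*} [TopologicalSpace G] [ChartedSpace E G] [Group G] (K Γ : Subgroup G)

/-- The quotient `K \ G` by the left translation action of `K`. -/
def LeftQuotient (E : Type*) {G : Type*} [Group G] (K : Subgroup G) : Type _ :=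
  Quotient (QuotientGroup.rightRel K)

instance : DiffeologicalSpace (LeftQuotient E K) :=
  quotientDiffeology (manifoldDiffeology E G) (Quotient.mk (QuotientGroup.rightRel K))
    Quotient.mk_surjective

/-- The double quotient `M_Γ = K \ G / Γ`. -/
def DoubleQuotient (E : Type*) {G : Type*} [Group G] (K Γ : Subgroup G) : Type _ :=
  DoubleCoset.Quotient (K : Set G) (Γ : Set G)

instance : DiffeologicalSpace (DoubleQuotient E K Γ) :=
  quotientDiffeology (manifoldDiffeology E G)
    (Quotient.mk (DoubleCoset.setoid (K : Set G) (Γ : Set G))) Quotient.mk_surjective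

variable {E K}

namespace LeftQuotient

/-- The coset `K g`. -/
def mk (g : G) : LeftQuotient E K := Quotient.mk (QuotientGroup.rightRel K) g

lemma mk_eq_mk {a b : G} : (mk a : LeftQuotient E K) = mk b ↔ b * a⁻¹ ∈ K :=
  (Quotient.eq (r := QuotientGroup.rightRel K)).trans QuotientGroup.rightRel_apply

lemma exists_mk (a : LeftQuotient E K) : ∃ g, mk g = a :=
  Quotient.inductionOn a fun g ↦ ⟨g, rfl⟩

/-- The right translation action of `G` on `K \ G`. -/
instance : MulAction Gᵐᵒᵖ (LeftQuotient E K) where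
  smul g := Quotient.map (sa := QuotientGroup.rightRel K) (sb := QuotientGroup.rightRel K)
    (fun a ↦ a * g.unop) (by
      intro a b h
      have h : b * a⁻¹ ∈ K := QuotientGroup.rightRel_apply.1 h
      exact QuotientGroup.rightRel_apply.2 (by simpa [mul_assoc] using h))
  one_smul a := by
    obtain ⟨g, rfl⟩ := exists_mk a
    exact congrArg mk (mul_one g)
  mul_smul x y a := by
    obtain ⟨g, rfl⟩ := exists_mk a
    exact congrArg mk (mul_assoc g y.unop x.unop).symm

lemma op_smul_mk (a g : G) : MulOpposite.op g • (mk a : LeftQuotient E K) = mk (a * g) := rfl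

/-- The projection `K \ G → K \ G / Γ`. -/
def toDoubleQuotient : LeftQuotient E K → DoubleQuotient E K Γ :=
  Quotient.lift (Quotient.mk (DoubleCoset.setoid (K : Set G) (Γ : Set G))) (by
    intro a b h
    have h : b * a⁻¹ ∈ K := QuotientGroup.rightRel_apply.1 h
    exact Quotient.sound (DoubleCoset.rel_iff.2 ⟨_, h, 1, Γ.one_mem, by simp⟩))

lemma toDoubleQuotient_smul (a : LeftQuotient E K) {γ : G} (hγ : γ ∈ Γ) :
    toDoubleQuotient Γ (MulOpposite.op γ • a) = toDoubleQuotient Γ a := by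
  obtain ⟨g, rfl⟩ := exists_mk a
  exact (Quotient.sound (DoubleCoset.rel_iff.2 ⟨1, K.one_mem, γ, hγ, by simp⟩)).symm

variable (E) in
/-- The bijection `ι : G / K → K \ G` that sends `g K` to `K g⁻¹`. -/
def ofInv : G ⧸ K ≃ LeftQuotient E K :=
  (QuotientGroup.quotientRightRelEquivQuotientLeftRel K).symm

lemma ofInv_coe (g : G) : ofInv E (g : G ⧸ K) = mk g⁻¹ := rfl

end LeftQuotient

/-! ### The universal flat bundle over `K \ G / Γ` -/

variable (K) in
/-- Two points `(a₁, g₁)`, `(a₂, g₂)` of `(K \ G) × G` are identified if `a₂ = a₁ γ⁻¹` and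
`g₂ = γ g₁` for some `γ ∈ Γ`. -/
def universalSetoid : Setoid (LeftQuotient E K × G) where
  r u v := ∃ γ ∈ Γ, v.1 = MulOpposite.op γ⁻¹ • u.1 ∧ v.2 = γ * u.2
  iseqv :=
    { refl := fun u ↦ ⟨1, Γ.one_mem, by simp, by simp⟩
      symm := by
        rintro u v ⟨γ, hγ, h₁, h₂⟩
        exact ⟨γ⁻¹, Γ.inv_mem hγ, by rw [h₁, smul_smul, ← MulOpposite.op_mul]; simp, by simp [h₂]⟩
      trans := by
        rintro u v w ⟨γ, hγ, h₁, h₂⟩ ⟨γ', hγ', h₃, h₄⟩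
        exact ⟨γ' * γ, Γ.mul_mem hγ' hγ, by rw [h₃, h₁, smul_smul, mul_inv_rev]; rfl,
          by rw [h₄, h₂, mul_assoc]⟩ }

variable (E K) in
/-- The universal bundle `𝓔_G` over `K \ G / Γ`, the quotient of `(K \ G) × G`. -/
def UniversalBundle : Type _ := Quotient (universalSetoid (E := E) K Γ)

namespace UniversalBundle

instance : DiffeologicalSpace (UniversalBundle E K Γ) :=
  prodLieQuotientDiffeology E (universalSetoid (E := E) K Γ)

variable {Γ}

/-- The class of `(a, g)` in `𝓔_G`. -/
def mk (a : LeftQuotient E K) (g : G) : UniversalBundle E K Γ :=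
  Quotient.mk (universalSetoid (E := E) K Γ) (a, g)

lemma exists_mk (e : UniversalBundle E K Γ) : ∃ a g, mk a g = e :=
  Quotient.inductionOn e fun u ↦ ⟨u.1, u.2, rfl⟩

/-- The bundle projection `𝓔_G → K \ G / Γ`. -/
def proj : UniversalBundle E K Γ → DoubleQuotient E K Γ :=
  Quotient.lift (fun u : LeftQuotient E K × G ↦ u.1.toDoubleQuotient Γ) (by
    rintro u v ⟨γ, hγ, h, -⟩
    rw [h, LeftQuotient.toDoubleQuotient_smul Γ _ (Γ.inv_mem hγ)])

/-- The right action of `G` on `𝓔_G`, by right translations of the second factor. -/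
instance : MulAction Gᵐᵒᵖ (UniversalBundle E K Γ) where
  smul g := Quotient.map (sa := universalSetoid (E := E) K Γ) (sb := universalSetoid (E := E) K Γ)
    (fun u ↦ (u.1, u.2 * g.unop)) (by
      rintro u v ⟨γ, hγ, h₁, h₂⟩
      exact ⟨γ, hγ, h₁, by simp [h₂, mul_assoc]⟩)
  one_smul e := by
    obtain ⟨x, g, rfl⟩ := exists_mk e
    exact congrArg (mk x) (mul_one g)
  mul_smul a b e := by
    obtain ⟨x, g, rfl⟩ := exists_mk e
    exact congrArg (mk x) (mul_assoc g b.unop a.unop).symm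

lemma proj_smul (g : Gᵐᵒᵖ) (e : UniversalBundle E K Γ) : (g • e).proj = e.proj := by
  obtain ⟨x, a, rfl⟩ := exists_mk e
  rfl

variable (E K Γ)

/-- The flat connection `𝓓⁰` on `𝓔_G`: the form to which the pullback of the left-invariant
Maurer-Cartan form along `(K \ G) × G → G` descends. -/
def connection [LieGroup 𝓘(ℝ, E) ∞ G] [DiscreteTopology Γ] : OneForm E (UniversalBundle E K Γ) :=
  descendedConnection E Γ (universalSetoid (E := E) K Γ) (by
    rintro u v ⟨γ, hγ, -, h⟩
    exact ⟨γ, hγ, h⟩)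

/-- The reduction `𝓔_K ⊆ 𝓔_G` to `K`: the image of `{(g⁻¹, g) | g ∈ G} ⊆ G × G`. -/
def reduction : Set (UniversalBundle E K Γ) :=
  Set.range fun g : G ↦ mk (LeftQuotient.mk g⁻¹) g

end UniversalBundle

end Quotients

/-! ### Pullbacks of the universal bundle -/

section Pullback

variable (E F : Type*) [NormedAddCommGroup E] [NormedSpace ℝ E]
  [NormedAddCommGroup F] [NormedSpace ℝ F]
  {G X : Type*} [TopologicalSpace G] [ChartedSpace E G] [Group G]
  [TopologicalSpace X] [ChartedSpace F X] {K Γ : Subgroup G} (H : X → DoubleQuotient E K Γ)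

/-- The pullback `H^* 𝓔_G = {(x, e) | H x = π e} ⊆ X × 𝓔_G`. -/
def PullbackBundle (E F : Type*) [NormedAddCommGroup E] [NormedSpace ℝ E]
    {G X : Type*} [TopologicalSpace G] [ChartedSpace E G] [Group G] {K Γ : Subgroup G}
    (H : X → DoubleQuotient E K Γ) : Type _ :=
  {w : X × UniversalBundle E K Γ // H w.1 = w.2.proj}

namespace PullbackBundle

instance : DiffeologicalSpace (PullbackBundle E F H) :=
  subtypeDiffeology (prodDiffeology (manifoldDiffeology F X) inferInstance) _

variable {E F H}

/-- The bundle projection `H^* 𝓔_G → X`. -/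
def proj (w : PullbackBundle E F H) : X := w.1.1

/-- The bundle map `H^* 𝓔_G → 𝓔_G`. -/
def toUniversal (w : PullbackBundle E F H) : UniversalBundle E K Γ := w.1.2

/-- The right action of `G` on `H^* 𝓔_G`. -/
instance : MulAction Gᵐᵒᵖ (PullbackBundle E F H) where
  smul g w := ⟨(w.1.1, g • w.1.2), w.2.trans (UniversalBundle.proj_smul g w.1.2).symm⟩
  one_smul w := Subtype.ext (Prod.ext rfl (one_smul _ w.1.2))
  mul_smul a b w := Subtype.ext (Prod.ext rfl (mul_smul a b w.1.2))

variable (E F H)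

/-- The pulled back connection `H^* 𝓓⁰`. -/
def connection [LieGroup 𝓘(ℝ, E) ∞ G] [DiscreteTopology Γ] : OneForm E (PullbackBundle E F H) :=
  (UniversalBundle.connection E K Γ).pullback toUniversal fun _ _ hp ↦ hp.2

/-- The pulled back reduction `H^* 𝓔_K`. -/
def reduction : Set (PullbackBundle E F H) :=
  {w | w.toUniversal ∈ UniversalBundle.reduction E K Γ}

end PullbackBundle

end Pullback

/-- An isomorphism of smooth principal `G`-bundles over `X`: a diffeomorphism that is
`G`-equivariant and covers the identity of `X`. -/
structure PrincipalIso (G : Type*) [Group G] {X P Q : Type*} [DiffeologicalSpace P]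
    [DiffeologicalSpace Q] [MulAction Gᵐᵒᵖ P] [MulAction Gᵐᵒᵖ Q] (πP : P → X) (πQ : Q → X)
    extends P ≃ Q where
  smooth : DSmooth toFun
  smooth_symm : DSmooth invFun
  map_smul : ∀ (g : Gᵐᵒᵖ) (e : P), toFun (g • e) = g • toFun e
  proj_eq : ∀ e : P, πQ (toFun e) = πP e

/-! ### The map to `K \ G / Γ` given by a reduction -/

section ClassifyingMap

variable {E F : Type*} [NormedAddCommGroup E] [NormedSpace ℝ E]
  [NormedAddCommGroup F] [NormedSpace ℝ F]
  {G X Xt : Type*} [TopologicalSpace G] [ChartedSpace E G] [Group G]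
  [TopologicalSpace X] [ChartedSpace F X]
  [TopologicalSpace Xt] [ChartedSpace F Xt] [SimplyConnectedSpace Xt]
  {β : Xt → X} {hβ : IsCoveringMap β} {x₀ : Xt}
  {K Γ : Subgroup G} {ρ : FundamentalGroup X (β x₀) →* Γ} {EK : Set (FlatBundle E F hβ x₀ ρ)}

namespace IsReduction

lemma exists_mk_mem (hEK : IsReduction E F hβ x₀ ρ K EK) (x : Xt) :
    ∃ g : G, FlatBundle.mk x g ∈ EK := by
  obtain ⟨U, -, hxU, s, hs, -⟩ := hEK.exists_section (β x)
  obtain ⟨hsx, hsEK⟩ := hs _ hxU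
  obtain ⟨y, g, hyg⟩ := FlatBundle.exists_mk (s (β x))
  rw [← hyg] at hsx hsEK
  obtain ⟨z, hz⟩ := exists_deck_eq F hβ x₀ y x hsx
  refine ⟨(ρ z : G)⁻¹ * g, ?_⟩
  rwa [← FlatBundle.mk_eq_mk.2 ⟨z, hz.symm, rfl⟩]

/-- The map `h : Xt → G / K` given by a reduction `E_K`: the fibre of `β^* E_K ⊆ Xt × G` over `x`
is the coset `h x`. -/
def equivariantMap (hEK : IsReduction E F hβ x₀ ρ K EK) (x : Xt) : G ⧸ K :=
  ((hEK.exists_mk_mem x).choose : G)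

lemma mk_mem_iff (hEK : IsReduction E F hβ x₀ ρ K EK) (x : Xt) (g : G) :
    FlatBundle.mk x g ∈ EK ↔ hEK.equivariantMap x = (g : G ⧸ K) := by
  have h₀ := (hEK.exists_mk_mem x).choose_spec
  rw [equivariantMap, QuotientGroup.eq]
  set a := (hEK.exists_mk_mem x).choose
  constructor
  · intro hg
    obtain ⟨k, hk, h⟩ := hEK.exists_smul_eq _ h₀ _ hg rfl
    obtain ⟨z, hz, hz'⟩ := FlatBundle.mk_eq_mk.1 h
    obtain rfl := eq_one_of_deck_eq F hβ x₀ z x hz.symm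
    have hak : a * k = g := by
      rw [map_one] at hz'
      simpa using hz'
    rwa [← hak, inv_mul_cancel_left]
  · intro hk
    have h := hEK.smul_mem _ h₀ _ hk
    have : MulOpposite.op (a⁻¹ * g) • (FlatBundle.mk x a : FlatBundle E F hβ x₀ ρ) =
        FlatBundle.mk x g := congrArg (FlatBundle.mk x) (mul_inv_cancel_left a g)
    rwa [this] at h

lemma equivariantMap_deck (hEK : IsReduction E F hβ x₀ ρ K EK)
    (z : FundamentalGroup X (β x₀)) (x : Xt) :
    hEK.equivariantMap (deck F hβ x₀ z x) = (ρ z : G)⁻¹ • hEK.equivariantMap x := by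
  obtain ⟨g, hg⟩ := hEK.exists_mk_mem x
  rw [(hEK.mk_mem_iff x g).1 hg, MulAction.Quotient.smul_coe, smul_eq_mul, ← mk_mem_iff]
  rwa [← FlatBundle.mk_eq_mk.2 ⟨z, rfl, rfl⟩]

lemma surjective (hEK : IsReduction E F hβ x₀ ρ K EK) : Function.Surjective β := by
  intro x
  obtain ⟨U, -, hxU, s, hs, -⟩ := hEK.exists_section x
  obtain ⟨y, g, hyg⟩ := FlatBundle.exists_mk (s x)
  exact ⟨y, by rw [← (hs x hxU).1, ← hyg]; rfl⟩

/-- The map `H_D : X → K \ G / Γ` to which the composition of `h : Xt → G / K` with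
`ι : G / K → K \ G` descends. -/
def classifyingMap (hEK : IsReduction E F hβ x₀ ρ K EK) (x : X) : DoubleQuotient E K Γ :=
  (LeftQuotient.ofInv E (hEK.equivariantMap (Function.surjInv hEK.surjective x))).toDoubleQuotient Γ

lemma classifyingMap_proj (hEK : IsReduction E F hβ x₀ ρ K EK) (x : Xt) :
    hEK.classifyingMap (β x) =
      (LeftQuotient.ofInv E (hEK.equivariantMap x)).toDoubleQuotient Γ := by
  obtain ⟨z, hz⟩ := exists_deck_eq F hβ x₀ x (Function.surjInv hEK.surjective (β x))
    (Function.surjInv_eq hEK.surjective (β x)).symm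
  rw [classifyingMap, ← hz, equivariantMap_deck]
  obtain ⟨g, hg⟩ := QuotientGroup.mk_surjective (hEK.equivariantMap x)
  rw [← hg, MulAction.Quotient.smul_coe, LeftQuotient.ofInv_coe, LeftQuotient.ofInv_coe,
    smul_eq_mul, mul_inv_rev, inv_inv, ← LeftQuotient.op_smul_mk,
    LeftQuotient.toDoubleQuotient_smul Γ _ (ρ z).2]

end IsReduction

end ClassifyingMap

end FlatPullback

end

open FlatPullback

noncomputable section

namespace FlatPullback

open Set Filter Topology

/-! Upstairs, on `Xt × G`, the bundle map is `(x, g) ↦ (ι (h x), g)`. It is equivariant because `h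
(x · z) = ρ(z)⁻¹ h x`, hence `ι (h (x · z)) = ι (h x) ρ(z)`, and it leaves the second factor alone.
Both assertions about `Φ` follow from this. The two connections descend from the Maurer-Cartan form
of the second factor, and descent is unique (`pullback_connection`). The two reductions are cut out
by `h x = gK` and by `ι (h x) = K g⁻¹`, which is the same condition (`image_toPullback`).

What remains is that `H_D` and `Φ` are smooth and that `Φ` has a smooth inverse. Smoothness rests on
`exists_contMDiff_representative`: a smooth local section of `E_K` lifts to `Xt × G`, and a deck
transformation moves the lift to the right sheet, so that `h` is locally represented by a smooth map
to `G`.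

The inverse uses the action of `Γ` on `K \ G`. Since `K` is compact and `Γ` is closed, discrete and
torsionfree, the action is free (`eq_one_of_conj_mem`), which makes `Φ` injective. It is also
proper, in the form that an element of `Γ` relating two continuous families of cosets is locally
constant (`eventually_eq_of_mul_mem`). Therefore plots of `H_D^* 𝓔_G` lift locally to plots of `Xt ×
G` (`exists_lift_toPullback`). -/

/-! ### Discrete subgroups and compact subgroups -/

section DiscreteSubgroup

variable {G : Type*} [TopologicalSpace G] [Group G] [IsTopologicalGroup G] {K Γ : Subgroup G}

/-- A torsionfree closed discrete subgroup acts freely on the cosets of a compact subgroup. -/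
lemma eq_one_of_conj_mem [DiscreteTopology Γ] (hK : IsCompact (K : Set G))
    (hΓ : IsClosed (Γ : Set G)) (htf : ∀ γ ∈ Γ, IsOfFinOrder γ → γ = 1)
    {γ : G} (hγ : γ ∈ Γ) (k : G) (h : k⁻¹ * γ * k ∈ K) : γ = 1 := by
  refine htf γ hγ ?_
  by_contra hinf
  -- A conjugate of `K` is compact, so it meets the closed discrete set `Γ` in a finite set. All
  -- powers of `γ` lie in this set, which is impossible if they are distinct.
  have hC : ((fun x ↦ k * x * k⁻¹) '' (K : Set G) ∩ Γ).Finite :=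
    ((hK.image (by fun_prop)).inter_right hΓ).finite
      (IsDiscrete.mono ⟨‹DiscreteTopology Γ›⟩ inter_subset_right)
  refine (Set.infinite_range_of_injective (injective_pow_iff_not_isOfFinOrder.2 hinf))
    (hC.subset ?_)
  rintro _ ⟨n, rfl⟩
  refine ⟨⟨(k⁻¹ * γ * k) ^ n, K.pow_mem h n, ?_⟩, Γ.pow_mem hγ n⟩
  have := conj_pow (i := n) (a := k⁻¹) (b := γ)
  rw [inv_inv] at this
  rw [this]
  group

/-- A torsionfree closed discrete subgroup acts properly on the cosets of a compact subgroup: if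
`γ t` carries one continuous family of cosets to another one, it is locally constant. -/
lemma eventually_eq_of_mul_mem [T2Space G] [DiscreteTopology Γ] (hK : IsCompact (K : Set G))
    (hΓ : IsClosed (Γ : Set G)) (htf : ∀ γ ∈ Γ, IsOfFinOrder γ → γ = 1)
    {T : Type*} [TopologicalSpace T] [LocallyCompactSpace T] {b k γ : T → G} (hb : Continuous b)
    (hk : Continuous k) {t₀ : T} (hγ : ∀ᶠ t in 𝓝 t₀, γ t ∈ Γ ∧ b t * γ t * k t ∈ K) :
    ∀ᶠ t in 𝓝 t₀, γ t = γ t₀ := by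
  obtain ⟨B, hB, hBn⟩ := exists_compact_mem_nhds t₀
  -- Solving `b t * γ t * k t ∈ K` for `γ t` with `t` in the compact neighbourhood `B` leaves only
  -- finitely many candidates. The map `γ` itself is not assumed continuous.
  let C : Set G := (fun u : T × G ↦ (b u.1)⁻¹ * u.2 * (k u.1)⁻¹) '' (B ×ˢ (K : Set G)) ∩ Γ
  have hC : C.Finite :=
    (((hB.prod hK).image (by fun_prop)).inter_right hΓ).finite
      (IsDiscrete.mono ⟨‹DiscreteTopology Γ›⟩ inter_subset_right)
  -- Each wrong candidate violates the relation at `t₀`, by freeness, and so violates it on a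
  -- neighbourhood of `t₀` because `K` is closed.
  have hfar : ∀ c ∈ C \ {γ t₀}, ∀ᶠ t in 𝓝 t₀, b t * c * k t ∉ K := by
    rintro c ⟨hc, hne⟩
    have hcl : IsClosed {t | b t * c * k t ∈ K} := hK.isClosed.preimage (by fun_prop)
    refine hcl.isOpen_compl.mem_nhds fun hmem ↦ hne ?_
    obtain ⟨hγ₀, hmem₀⟩ := hγ.self_of_nhds
    -- This is the product of the inverse of `b t₀ * γ t₀ * k t₀` with `b t₀ * c * k t₀`; the factor
    -- `b t₀` cancels.
    have h : (k t₀)⁻¹ * ((γ t₀)⁻¹ * c) * k t₀ ∈ K := by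
      have := K.mul_mem (K.inv_mem hmem₀) hmem
      simpa [mul_assoc] using this
    have := eq_one_of_conj_mem hK hΓ htf (Γ.mul_mem (Γ.inv_mem hγ₀) hc.2) _ h
    exact (inv_mul_eq_one.1 this).symm
  filter_upwards [((hC.subset sdiff_subset).eventually_all).2 hfar, hγ, hBn] with t h₁ h₂ h₃
  by_contra hne
  exact h₁ (γ t) ⟨⟨⟨(t, b t * γ t * k t), ⟨h₃, h₂.2⟩, by simp [mul_assoc]⟩, h₂.1⟩, hne⟩ h₂.2

end DiscreteSubgroup

/-! ### Equality of classes in `K \ G / Γ` and in `𝓔_G` -/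

lemma LeftQuotient.toDoubleQuotient_eq_iff {E G : Type*} [NormedAddCommGroup E] [NormedSpace ℝ E]
    [TopologicalSpace G] [ChartedSpace E G] [Group G] {K Γ : Subgroup G}
    {a b : LeftQuotient E K} :
    a.toDoubleQuotient Γ = b.toDoubleQuotient Γ ↔ ∃ γ ∈ Γ, b = MulOpposite.op γ • a := by
  constructor
  · obtain ⟨g, rfl⟩ := LeftQuotient.exists_mk a
    obtain ⟨k, rfl⟩ := LeftQuotient.exists_mk b
    intro h
    obtain ⟨c, hc, γ, hγ, h⟩ := DoubleCoset.rel_iff.1 (Quotient.exact h)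
    refine ⟨γ, hγ, ?_⟩
    rw [LeftQuotient.op_smul_mk, LeftQuotient.mk_eq_mk, h]
    simpa [mul_assoc] using hc
  · rintro ⟨γ, hγ, rfl⟩
    exact (LeftQuotient.toDoubleQuotient_smul Γ a hγ).symm

lemma UniversalBundle.mk_eq_mk {E G : Type*} [NormedAddCommGroup E] [NormedSpace ℝ E]
    [TopologicalSpace G] [ChartedSpace E G] [Group G] {K Γ : Subgroup G}
    {a b : LeftQuotient E K} {g k : G} :
    (UniversalBundle.mk a g : UniversalBundle E K Γ) = UniversalBundle.mk b k ↔
      ∃ γ ∈ Γ, b = MulOpposite.op γ⁻¹ • a ∧ k = γ * g :=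
  Quotient.eq (r := universalSetoid (E := E) K Γ)

/-! ### Lifts of plots -/

/-- Every smooth map from `ℝⁿ` to the target of a surjective local diffeomorphism lifts locally. -/
lemma exists_contMDiff_lift {F X Xt : Type*} [NormedAddCommGroup F] [NormedSpace ℝ F]
    [TopologicalSpace X] [ChartedSpace F X] [TopologicalSpace Xt] [ChartedSpace F Xt]
    {β : Xt → X} (hβ : IsLocalDiffeomorph 𝓘(ℝ, F) 𝓘(ℝ, F) ∞ β) (hsurj : Function.Surjective β)
    {n : ℕ} {p : EuclideanSpace ℝ (Fin n) → X}
    (hp : ContMDiff 𝓘(ℝ, EuclideanSpace ℝ (Fin n)) 𝓘(ℝ, F) ∞ p) (t₀ : EuclideanSpace ℝ (Fin n)) :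
    ∃ x : EuclideanSpace ℝ (Fin n) → Xt,
      ContMDiff 𝓘(ℝ, EuclideanSpace ℝ (Fin n)) 𝓘(ℝ, F) ∞ x ∧ β ∘ x =ᶠ[𝓝 t₀] p := by
  obtain ⟨y, hy⟩ := hsurj (p t₀)
  have hU : p ⁻¹' (hβ y).localInverse.source ∈ 𝓝 t₀ :=
    hp.continuous.continuousAt ((hβ y).localInverse_open_source.mem_nhds
      (hy ▸ (hβ y).localInverse_mem_source))
  -- Plots are defined on all of `ℝⁿ`, whereas the local inverse exists only near `p t₀`.
  -- Precomposing with a cutoff that is the identity near `t₀` makes the lift global without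
  -- changing its germ.
  obtain ⟨f, hf, hfU, hfid⟩ := exists_cutoff hU
  refine ⟨(hβ y).localInverse ∘ p ∘ f,
    (hβ y).contmdiffOn_localInverse.comp_contMDiff (hp.comp hf.contMDiff) hfU, ?_⟩
  filter_upwards [hfid] with t ht
  refine ((hβ y).localInverse_right_inv (hfU t)).trans ?_
  rw [ht, id]

namespace IsReduction

variable {E F : Type*} [NormedAddCommGroup E] [NormedSpace ℝ E]
  [NormedAddCommGroup F] [NormedSpace ℝ F]
  {G X Xt : Type*} [TopologicalSpace G] [ChartedSpace E G] [Group G] [LieGroup 𝓘(ℝ, E) ∞ G]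
  [TopologicalSpace X] [ChartedSpace F X]
  [TopologicalSpace Xt] [ChartedSpace F Xt] [SimplyConnectedSpace Xt]
  {β : Xt → X} {hβ : IsCoveringMap β} {x₀ : Xt}
  {K Γ : Subgroup G} {ρ : FundamentalGroup X (β x₀) →* Γ} {EK : Set (FlatBundle E F hβ x₀ ρ)}

/-! ### Smoothness of `h` and of `H_D` -/

/-- Along a plot of `Xt` the map `h : Xt → G / K` lifts locally to a smooth map to `G`. -/
lemma exists_contMDiff_representative (hEK : IsReduction E F hβ x₀ ρ K EK)
    (hβs : ContMDiff 𝓘(ℝ, F) 𝓘(ℝ, F) ∞ β) {n : ℕ} {x : EuclideanSpace ℝ (Fin n) → Xt}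
    (hx : ContMDiff 𝓘(ℝ, EuclideanSpace ℝ (Fin n)) 𝓘(ℝ, F) ∞ x) (t₀ : EuclideanSpace ℝ (Fin n)) :
    ∃ k : EuclideanSpace ℝ (Fin n) → G,
      ContMDiff 𝓘(ℝ, EuclideanSpace ℝ (Fin n)) 𝓘(ℝ, E) ∞ k ∧
      ∀ᶠ t in 𝓝 t₀, hEK.equivariantMap (x t) = (k t : G ⧸ K) := by
  obtain ⟨U, hU, hxU, s, hs, hsm⟩ := hEK.exists_section (β (x t₀))
  have hn : (β ∘ x) ⁻¹' U ∈ 𝓝 t₀ :=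
    (hβs.comp hx).continuous.continuousAt (hU.mem_nhds hxU)
  obtain ⟨f, hf, hfU, hfid⟩ := exists_cutoff hn
  -- The section of `E_K` along `β ∘ x` is a plot of a quotient of `Xt × G`, so near `t₀` it has a
  -- smooth lift `r`. The first component of `r` lies over the same points of `X` as `x`, but
  -- possibly on another sheet.
  obtain ⟨r, hr, hrs⟩ := hsm n (β ∘ x ∘ f) ((hβs.comp hx).comp hf.contMDiff) hfU t₀
  have hr₁ : ContMDiff 𝓘(ℝ, EuclideanSpace ℝ (Fin n)) 𝓘(ℝ, F) ∞ fun t ↦ (r t).1 := hr.1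
  have hr₂ : ContMDiff 𝓘(ℝ, EuclideanSpace ℝ (Fin n)) 𝓘(ℝ, E) ∞ fun t ↦ (r t).2 := hr.2
  have hmem : ∀ᶠ t in 𝓝 t₀, β (r t).1 = β (x t) ∧
      hEK.equivariantMap (r t).1 = ((r t).2 : G ⧸ K) := by
    filter_upwards [hrs, hfid] with t h₁ h₂
    have h₁ : FlatBundle.mk (r t).1 (r t).2 = s (β (x (f t))) := h₁
    have h₃ := hs (β (x (f t))) (hfU t)
    rw [← h₁] at h₃
    refine ⟨?_, (hEK.mk_mem_iff _ _).1 h₃.2⟩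
    have h₄ : β (r t).1 = β (x (f t)) := h₃.1
    rw [h₄, h₂, id]
  -- The sheets are matched at `t₀` by a deck transformation. Since `β` is injective near `(r
  -- t₀).1`, the same `z` matches them for all nearby `t`, and equivariance of `h` turns `(r t).2`
  -- into the representative `ρ(z) (r t).2` at `x t`.
  obtain ⟨z, hz⟩ := exists_deck_eq F hβ x₀ (x t₀) (r t₀).1 hmem.self_of_nhds.1.symm
  obtain ⟨V, hV, hVm, hinj⟩ := hβ.isLocalHomeomorph.isLocallyInjective (r t₀).1
  have e₁ : ∀ᶠ t in 𝓝 t₀, (r t).1 ∈ V := hr₁.continuous.continuousAt (hV.mem_nhds hVm)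
  have e₂ : ∀ᶠ t in 𝓝 t₀, deck F hβ x₀ z (x t) ∈ V :=
    ((deck F hβ x₀ z).continuous.comp hx.continuous).continuousAt (hV.mem_nhds (by
      rwa [Function.comp_apply, hz]))
  refine ⟨fun t ↦ (ρ z : G) * (r t).2, contMDiff_const.mul hr₂, ?_⟩
  filter_upwards [hmem, e₁, e₂] with t h₁ h₂ h₃
  have h₄ : deck F hβ x₀ z (x t) = (r t).1 :=
    hinj h₃ h₂ ((proj_deck F hβ x₀ z (x t)).trans h₁.1.symm)
  rw [← smul_eq_mul, ← MulAction.Quotient.smul_coe, ← h₁.2, ← h₄, equivariantMap_deck,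
    smul_inv_smul]

lemma dSmooth_ofInv_equivariantMap (hEK : IsReduction E F hβ x₀ ρ K EK)
    (hβs : ContMDiff 𝓘(ℝ, F) 𝓘(ℝ, F) ∞ β) :
    @DSmooth _ _ (manifoldDiffeology F Xt) _ fun x ↦ LeftQuotient.ofInv E (hEK.equivariantMap x) := by
  intro n x hx t₀
  obtain ⟨k, hk, h⟩ := hEK.exists_contMDiff_representative hβs hx t₀
  refine ⟨fun t ↦ (k t)⁻¹, hk.inv, ?_⟩
  filter_upwards [h] with t ht
  exact (congrArg (LeftQuotient.ofInv E) ht).symm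

/-- Plots of `X` lift locally to `Xt`, and there `k⁻¹` represents `ι ∘ h` when `k` represents `h`.
-/
lemma dSmooth_classifyingMap (hEK : IsReduction E F hβ x₀ ρ K EK)
    (hβ' : IsLocalDiffeomorph 𝓘(ℝ, F) 𝓘(ℝ, F) ∞ β) :
    @DSmooth _ _ (manifoldDiffeology F X) _ hEK.classifyingMap := by
  intro n p hp t₀
  obtain ⟨x, hx, hxp⟩ := exists_contMDiff_lift hβ' hEK.surjective hp t₀
  obtain ⟨k, hk, h⟩ := hEK.exists_contMDiff_representative hβ'.contMDiff hx t₀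
  refine ⟨fun t ↦ (k t)⁻¹, hk.inv, ?_⟩
  filter_upwards [h, hxp] with t ht htp
  change _ = hEK.classifyingMap (p t)
  rw [← htp, Function.comp_apply, classifyingMap_proj, ht]
  rfl

/-! ### The bundle map `Φ`, its effect on reductions and connections -/

/-- The bundle map `E_G → 𝓔_G` induced by `(x, g) ↦ (ι (h x), g)`. -/
def toUniversal (hEK : IsReduction E F hβ x₀ ρ K EK) :
    FlatBundle E F hβ x₀ ρ → UniversalBundle E K Γ :=
  Quotient.lift
    (fun u : Xt × G ↦ UniversalBundle.mk (LeftQuotient.ofInv E (hEK.equivariantMap u.1)) u.2) (by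
      rintro ⟨x, g⟩ ⟨y, k⟩ ⟨z, hz, hk⟩
      dsimp only at hz hk ⊢
      -- The identifying element of `Γ` is `ρ(z)⁻¹`: if `h x = aK`, then `ι (ρ(z)⁻¹ a K) = K a⁻¹
      -- ρ(z)`.
      refine UniversalBundle.mk_eq_mk.2 ⟨_, Γ.inv_mem (ρ z).2, ?_, hk⟩
      rw [hz, equivariantMap_deck]
      obtain ⟨a, ha⟩ := QuotientGroup.mk_surjective (hEK.equivariantMap x)
      rw [← ha, MulAction.Quotient.smul_coe, LeftQuotient.ofInv_coe, LeftQuotient.ofInv_coe,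
        LeftQuotient.op_smul_mk, smul_eq_mul, mul_inv_rev])

/-- The bundle map `Φ : E_G → H_D^* 𝓔_G` over `X`. -/
def toPullback (hEK : IsReduction E F hβ x₀ ρ K EK) (e : FlatBundle E F hβ x₀ ρ) :
    PullbackBundle E F hEK.classifyingMap :=
  ⟨(e.proj, hEK.toUniversal e), by
    obtain ⟨x, g, rfl⟩ := FlatBundle.exists_mk e
    exact hEK.classifyingMap_proj x⟩

lemma toPullback_smul (hEK : IsReduction E F hβ x₀ ρ K EK) (g : Gᵐᵒᵖ)
    (e : FlatBundle E F hβ x₀ ρ) : hEK.toPullback (g • e) = g • hEK.toPullback e := by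
  obtain ⟨x, a, rfl⟩ := FlatBundle.exists_mk e
  rfl

lemma dSmooth_toPullback (hEK : IsReduction E F hβ x₀ ρ K EK)
    (hβs : ContMDiff 𝓘(ℝ, F) 𝓘(ℝ, F) ∞ β) : DSmooth hEK.toPullback := by
  intro n p hp
  refine ⟨?_, ?_⟩
  · intro t₀
    obtain ⟨r, hr, hrp⟩ := hp t₀
    have hr₁ : ContMDiff 𝓘(ℝ, EuclideanSpace ℝ (Fin n)) 𝓘(ℝ, F) ∞ fun t ↦ (r t).1 := hr.1
    refine (hβs.comp hr₁).contMDiffAt.congr_of_eventuallyEq ?_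
    filter_upwards [hrp] with t ht
    rw [Function.comp_apply, ← ht]
    rfl
  · intro t₀
    obtain ⟨r, hr, hrp⟩ := hp t₀
    refine ⟨fun t ↦ (LeftQuotient.ofInv E (hEK.equivariantMap (r t).1), (r t).2),
      ⟨hEK.dSmooth_ofInv_equivariantMap hβs _ _ hr.1, hr.2⟩, ?_⟩
    filter_upwards [hrp] with t ht
    rw [Function.comp_apply, Function.comp_apply, ← ht]
    rfl

lemma toPullback_surjective (hEK : IsReduction E F hβ x₀ ρ K EK) :
    Function.Surjective hEK.toPullback := by
  rintro ⟨⟨y, e⟩, h⟩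
  obtain ⟨x, rfl⟩ := hEK.surjective y
  obtain ⟨a, g, rfl⟩ := UniversalBundle.exists_mk e
  dsimp only at h
  rw [classifyingMap_proj] at h
  obtain ⟨γ, hγ, rfl⟩ := LeftQuotient.toDoubleQuotient_eq_iff.1 h
  -- The given point is `[ι (h x) γ, g]`, and moving `γ` across to the second factor gives `[ι (h
  -- x), γ g]`.
  refine ⟨FlatBundle.mk x (γ * g), Subtype.ext (Prod.ext rfl ?_)⟩
  refine UniversalBundle.mk_eq_mk.2 ⟨γ⁻¹, Γ.inv_mem hγ, by rw [inv_inv], by simp⟩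

/-- The map `Φ` carries `E_K` to `H_D^* 𝓔_K`. -/
lemma image_toPullback (hEK : IsReduction E F hβ x₀ ρ K EK) :
    hEK.toPullback '' EK = PullbackBundle.reduction E F hEK.classifyingMap := by
  ext w
  constructor
  · rintro ⟨e, he, rfl⟩
    obtain ⟨x, g, rfl⟩ := FlatBundle.exists_mk e
    refine ⟨g, ?_⟩
    change _ = UniversalBundle.mk (LeftQuotient.ofInv E (hEK.equivariantMap x)) g
    rw [(hEK.mk_mem_iff x g).1 he, LeftQuotient.ofInv_coe]
  · rintro ⟨g, hg⟩
    obtain ⟨e, rfl⟩ := hEK.toPullback_surjective w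
    obtain ⟨x, k, rfl⟩ := FlatBundle.exists_mk e
    -- From `[K g⁻¹, g] = [ι (h x), k]` one gets `k = γ g` and `ι (h x) = K g⁻¹ γ⁻¹ = K k⁻¹`.
    -- Injectivity of `ι` then gives `h x = kK`; injectivity of `Φ` is not needed.
    refine ⟨_, (hEK.mk_mem_iff x k).2 ((LeftQuotient.ofInv E).injective ?_), rfl⟩
    obtain ⟨γ, hγ, h₁, h₂⟩ := UniversalBundle.mk_eq_mk.1 hg
    have h₂ : k = γ * g := h₂
    rw [h₁, h₂, LeftQuotient.op_smul_mk, LeftQuotient.ofInv_coe, mul_inv_rev]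

/-- The map `Φ` takes `H_D^* 𝓓⁰` to `D`. -/
lemma pullback_connection [DiscreteTopology Γ] (hEK : IsReduction E F hβ x₀ ρ K EK)
    (hΦ : DSmooth hEK.toPullback) (hβs : ContMDiff 𝓘(ℝ, F) 𝓘(ℝ, F) ∞ β) :
    (PullbackBundle.connection E F hEK.classifyingMap).pullback hEK.toPullback hΦ =
      FlatBundle.connection E F hβ x₀ ρ := by
  let _ := manifoldDiffeology F Xt
  -- By uniqueness of descent it is enough that the left-hand side pulls back to the trivial
  -- connection on `Xt × G`.
  refine (existsUnique_trivialConnection_descends E Γ (flatSetoid F hβ x₀ ρ) (by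
    rintro u v ⟨z, -, h⟩
    exact ⟨(ρ z : G)⁻¹, Γ.inv_mem (ρ z).2, h⟩)).choose_spec.2 _ ?_
  let _ := prodLieDiffeology E Xt G
  let _ := prodLieDiffeology E (LeftQuotient E K) G
  refine OneForm.ext fun n p hp t ↦ ?_
  have hU := (existsUnique_trivialConnection_descends E Γ (universalSetoid (E := E) K Γ) (by
    rintro u v ⟨γ, hγ, -, h⟩
    exact ⟨γ, hγ, h⟩)).choose_spec.1
  -- The image of the plot `p` in `𝓔_G` lifts to `r`, whose second component is that of `p`. The
  -- trivial connections therefore agree on `p` and `r`, and the defining property of `𝓓⁰` evaluated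
  -- on `r` is the claim.
  let r : EuclideanSpace ℝ (Fin n) → LeftQuotient E K × G :=
    fun t ↦ (LeftQuotient.ofInv E (hEK.equivariantMap (p t).1), (p t).2)
  have hr : IsPlot r := ⟨hEK.dSmooth_ofInv_equivariantMap hβs _ _ hp.1, hp.2⟩
  exact congrArg (fun θ : OneForm E (LeftQuotient E K × G) ↦ θ.toFun r hr t) hU

/-! ### Injectivity of `Φ` and smoothness of its inverse -/

/-- Two points with the same image can be represented over the same `x` in `Xt`. The element of `Γ`
that identifies their images then fixes the coset `ι (h x)`, so it is trivial by freeness. -/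
lemma toPullback_injective [DiscreteTopology Γ] (hEK : IsReduction E F hβ x₀ ρ K EK)
    (hK : IsCompact (K : Set G)) (hΓ : IsClosed (Γ : Set G))
    (htf : ∀ γ ∈ Γ, IsOfFinOrder γ → γ = 1) :
    Function.Injective hEK.toPullback := by
  have := topologicalGroup_of_lieGroup 𝓘(ℝ, E) ∞ (G := G)
  intro e e' h
  obtain ⟨x, g, rfl⟩ := FlatBundle.exists_mk e
  obtain ⟨y, k, rfl⟩ := FlatBundle.exists_mk e'
  have hxy : β y = β x := (congrArg PullbackBundle.proj h).symm
  obtain ⟨z, rfl⟩ := exists_deck_eq F hβ x₀ y x hxy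
  rw [(FlatBundle.mk_eq_mk.2 ⟨z, rfl, rfl⟩ : FlatBundle.mk y k = FlatBundle.mk _ _)] at h ⊢
  set x := deck F hβ x₀ z y
  obtain ⟨γ, hγ, h₁, h₂⟩ := UniversalBundle.mk_eq_mk.1 (congrArg PullbackBundle.toUniversal h)
  obtain ⟨a, ha⟩ := QuotientGroup.mk_surjective (hEK.equivariantMap x)
  rw [← ha, LeftQuotient.ofInv_coe, LeftQuotient.op_smul_mk, LeftQuotient.mk_eq_mk] at h₁
  have h₃ := eq_one_of_conj_mem hK hΓ htf (Γ.inv_mem hγ) a (by simpa using h₁)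
  have h₂ : (ρ z : G)⁻¹ * k = γ * g := h₂
  rw [h₂, inv_eq_one.1 h₃, one_mul]

/-- Plots of `H_D^* 𝓔_G` lift locally to plots of `Xt × G`. -/
lemma exists_lift_toPullback [T2Space G] [DiscreteTopology Γ]
    (hEK : IsReduction E F hβ x₀ ρ K EK)
    (hK : IsCompact (K : Set G)) (hΓ : IsClosed (Γ : Set G))
    (htf : ∀ γ ∈ Γ, IsOfFinOrder γ → γ = 1)
    (hβ' : IsLocalDiffeomorph 𝓘(ℝ, F) 𝓘(ℝ, F) ∞ β) {n : ℕ}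
    {w : EuclideanSpace ℝ (Fin n) → PullbackBundle E F hEK.classifyingMap} (hw : IsPlot w)
    (t₀ : EuclideanSpace ℝ (Fin n)) :
    ∃ (x : EuclideanSpace ℝ (Fin n) → Xt) (g : EuclideanSpace ℝ (Fin n) → G),
      ContMDiff 𝓘(ℝ, EuclideanSpace ℝ (Fin n)) 𝓘(ℝ, F) ∞ x ∧
      ContMDiff 𝓘(ℝ, EuclideanSpace ℝ (Fin n)) 𝓘(ℝ, E) ∞ g ∧
      ∀ᶠ t in 𝓝 t₀, hEK.toPullback (FlatBundle.mk (x t) (g t)) = w t := by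
  have := topologicalGroup_of_lieGroup 𝓘(ℝ, E) ∞ (G := G)
  obtain ⟨x, hx, hxw⟩ := exists_contMDiff_lift hβ' hEK.surjective hw.1 t₀
  obtain ⟨k, hk, hkx⟩ := hEK.exists_contMDiff_representative hβ'.contMDiff hx t₀
  obtain ⟨r, hr, hrw⟩ := hw.2 t₀
  obtain ⟨b, hb, hbr⟩ := hr.1 t₀
  have hb : ContMDiff 𝓘(ℝ, EuclideanSpace ℝ (Fin n)) 𝓘(ℝ, E) ∞ b := hb
  have hr₂ : ContMDiff 𝓘(ℝ, EuclideanSpace ℝ (Fin n)) 𝓘(ℝ, E) ∞ fun t ↦ (r t).2 := hr.2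
  -- The lifts `x`, `k`, `r`, `b` satisfy their relations only near `t₀`. Stating these as premises
  -- allows a choice of `γ t` for every `t`, with the arbitrary value `1` where a relation fails.
  have hex : ∀ t, ∃ γ : G, hEK.equivariantMap (x t) = (k t : G ⧸ K) →
      β (x t) = (w t).1.1 → LeftQuotient.mk (b t) = (r t).1 →
      UniversalBundle.mk (r t).1 (r t).2 = (w t).1.2 →
      γ ∈ Γ ∧ (r t).1 = MulOpposite.op γ⁻¹ • LeftQuotient.mk (k t)⁻¹ ∧ b t * γ * k t ∈ K := by
    intro t
    by_cases h : hEK.equivariantMap (x t) = (k t : G ⧸ K) ∧ β (x t) = (w t).1.1 ∧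
      LeftQuotient.mk (b t) = (r t).1 ∧ UniversalBundle.mk (r t).1 (r t).2 = (w t).1.2
    · obtain ⟨h₁, h₂, h₃, h₄⟩ := h
      have h₅ := (w t).2
      rw [← h₂, ← h₄, classifyingMap_proj, h₁, LeftQuotient.ofInv_coe] at h₅
      obtain ⟨γ, hγ, h₆⟩ := LeftQuotient.toDoubleQuotient_eq_iff.1 h₅
      refine ⟨γ⁻¹, fun _ _ _ _ ↦ ⟨Γ.inv_mem hγ, by rwa [inv_inv], ?_⟩⟩
      rw [← h₃, LeftQuotient.op_smul_mk, eq_comm, LeftQuotient.mk_eq_mk] at h₆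
      simpa [mul_assoc] using h₆
    · exact ⟨1, fun h₁ h₂ h₃ h₄ ↦ (h ⟨h₁, h₂, h₃, h₄⟩).elim⟩
  choose γ hγ using hex
  have hev : ∀ᶠ t in 𝓝 t₀, γ t ∈ Γ ∧ (r t).1 = MulOpposite.op (γ t)⁻¹ • LeftQuotient.mk (k t)⁻¹ ∧
      b t * γ t * k t ∈ K := by
    filter_upwards [hxw, hkx, hrw, hbr] with t h₁ h₂ h₃ h₄
    exact hγ t h₂ h₁ h₄ h₃
  -- The elements `γ t` were chosen pointwise; properness makes them constant near `t₀`. Hence `(γ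
  -- t₀)⁻¹ * (r t).2` is a smooth second component for the lift.
  have hconst := eventually_eq_of_mul_mem hK hΓ htf hb.continuous hk.continuous
    (hev.mono fun t h ↦ ⟨h.1, h.2.2⟩)
  refine ⟨x, fun t ↦ (γ t₀)⁻¹ * (r t).2, hx, contMDiff_const.mul hr₂, ?_⟩
  filter_upwards [hxw, hkx, hrw, hev, hconst] with t h₁ h₂ h₃ h₄ h₅
  refine Subtype.ext (Prod.ext h₁ (Eq.trans ?_ h₃))
  refine UniversalBundle.mk_eq_mk.2 ⟨γ t, h₄.1, ?_, by rw [h₅, mul_inv_cancel_left]⟩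
  rw [h₂, LeftQuotient.ofInv_coe, h₄.2.1]

/-- The isomorphism `Φ : E_G → H_D^* 𝓔_G` of principal bundles. -/
def pullbackIso [T2Space G] [DiscreteTopology Γ]
    (hEK : IsReduction E F hβ x₀ ρ K EK)
    (hK : IsCompact (K : Set G)) (hΓ : IsClosed (Γ : Set G))
    (htf : ∀ γ ∈ Γ, IsOfFinOrder γ → γ = 1)
    (hβ' : IsLocalDiffeomorph 𝓘(ℝ, F) 𝓘(ℝ, F) ∞ β) :
    PrincipalIso G (FlatBundle.proj : FlatBundle E F hβ x₀ ρ → X)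
      (PullbackBundle.proj : PullbackBundle E F hEK.classifyingMap → X) where
  toEquiv := .ofBijective hEK.toPullback
    ⟨hEK.toPullback_injective hK hΓ htf, hEK.toPullback_surjective⟩
  smooth := hEK.dSmooth_toPullback hβ'.contMDiff
  smooth_symm := by
    intro n w hw t₀
    obtain ⟨x, g, hx, hg, h⟩ := hEK.exists_lift_toPullback hK hΓ htf hβ' hw t₀
    refine ⟨fun t ↦ (x t, g t), ⟨hx, hg⟩, ?_⟩
    filter_upwards [h] with t ht
    exact (Equiv.eq_symm_apply (.ofBijective hEK.toPullback
      ⟨hEK.toPullback_injective hK hΓ htf, hEK.toPullback_surjective⟩)).2 ht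
  map_smul := hEK.toPullback_smul
  proj_eq _ := rfl

end IsReduction

end FlatPullback

end

theorem mainTheorem3
    {E F : Type*} [NormedAddCommGroup E] [NormedSpace ℝ E] [FiniteDimensional ℝ E]
    [NormedAddCommGroup F] [NormedSpace ℝ F] [FiniteDimensional ℝ F]
    -- the simple Lie group `G`
    {G : Type*} [TopologicalSpace G] [ChartedSpace E G] [Group G] [LieGroup 𝓘(ℝ, E) ∞ G]
    [T2Space G] [ConnectedSpace G] [NoncompactSpace G]
    (hG : HasSimpleLieAlgebra E G) (hcenter : Subgroup.center G = ⊥)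
    -- the maximal compact subgroup `K`, whose center has positive dimension
    (K : Subgroup G) (hK : Maximal (fun L : Subgroup G ↦ IsCompact (L : Set G)) K)
    (hKcenter : ¬ DiscreteTopology (Subgroup.center K))
    -- the closed torsionfree discrete subgroup `Γ`
    (Γ : Subgroup G) [DiscreteTopology Γ] (hΓ : IsClosed (Γ : Set G))
    (hΓtf : ∀ γ ∈ Γ, IsOfFinOrder γ → γ = 1)
    -- the compact connected manifold `X` and its universal cover `β : Xt → X`
    {X : Type*} [TopologicalSpace X] [ChartedSpace F X] [IsManifold 𝓘(ℝ, F) ∞ X]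
    [T2Space X] [CompactSpace X] [ConnectedSpace X]
    {Xt : Type*} [TopologicalSpace Xt] [ChartedSpace F Xt] [IsManifold 𝓘(ℝ, F) ∞ Xt]
    [SimplyConnectedSpace Xt]
    {β : Xt → X} (hβ : IsCoveringMap β) (hβ' : IsLocalDiffeomorph 𝓘(ℝ, F) 𝓘(ℝ, F) ∞ β)
    (x₀ : Xt)
    -- the representation `ρ` of the fundamental group
    (ρ : FundamentalGroup X (β x₀) →* Γ)
    (hρ : AdCompletelyReducible E (Set.range fun z ↦ (ρ z : G)))
    -- the reduction `E_K` of the flat bundle `E_G` to `K`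
    (EK : Set (FlatBundle E F hβ x₀ ρ)) (hEK : IsReduction E F hβ x₀ ρ K EK) :
    -- the map `H_D` is `C^∞`
    @DSmooth _ _ (manifoldDiffeology F X) _ hEK.classifyingMap ∧
    -- the isomorphism `Φ : E_G → H_D^* 𝓔_G` of principal `G`-bundles over `X`
    ∃ Φ : PrincipalIso G (FlatBundle.proj : FlatBundle E F hβ x₀ ρ → X)
        (PullbackBundle.proj : PullbackBundle E F hEK.classifyingMap → X),
      -- it is the canonical one, induced by `(x, g) ↦ (ι (h x), g)`
      (∀ (x : Xt) (g : G), (Φ.toEquiv (FlatBundle.mk x g)).toUniversal =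
        UniversalBundle.mk (LeftQuotient.ofInv E (hEK.equivariantMap x)) g) ∧
      -- it takes `H_D^* 𝓓⁰` to `D`
      (PullbackBundle.connection E F hEK.classifyingMap).pullback Φ.toFun Φ.smooth =
        FlatBundle.connection E F hβ x₀ ρ ∧
      -- it takes `H_D^* 𝓔_K` to `E_K`
      Φ.toEquiv '' EK = PullbackBundle.reduction E F hEK.classifyingMap := by
  exact ⟨hEK.dSmooth_classifyingMap hβ', hEK.pullbackIso hK.1 hΓ hΓtf hβ', fun _ _ ↦ rfl,
    hEK.pullback_connection _ hβ'.contMDiff, hEK.image_toPullback⟩
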